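/- For every $\alpha>0$ there exist $c>0$ and $n_0$ such that the following holds. Let $G=(V,E)$ be a finite simple graph on $n\ge n_0$ vertices with maximum degree $d\ge 1$, and suppose that its edge isoperimetric number $$i(G)=\min_{\substack{\emptyset\ne U\subseteq V\\ |U|\le |V|/2}}\frac{e_G(U,V\setminus U)}{|U|}$$ satisfies $i(G)\ge \alpha d$, where $e_G(U,V\setminus U)$ is the number of edges of $G$ with one endpoint in $U$ and the other in $V\setminus U$. Then $ccl(G)\ge c\sqrt{n}$, where $ccl(G)$ is the largest $k$ such that the complete graph $K_k$ is a minor of $G$, that is, such that there are pairwise disjoint vertex sets $U_1,\dots,U_k\subseteq V$, each spanning a connected (nonempty) subgraph of $G$, with an edge of $G$ between $U_i$ and $U_j$ whenever $i\ne j$. -/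

import Mathlib

/-- `G` contains `H` as a minor: there are supernodes `B w`, each spanning a connected (in
particular nonempty) subgraph of `G`, pairwise disjoint, such that for every edge `w w'` of `H`
the graph `G` has an edge between `B w` and `B w'`. -/
def HasMinor {V W : Type*} (G : SimpleGraph V) (H : SimpleGraph W) : Prop :=
  ∃ B : W → Set V,
    (∀ w, (G.induce (B w)).Connected) ∧
    (∀ w w', w ≠ w' → Disjoint (B w) (B w')) ∧
    (∀ w w', H.Adj w w' → ∃ x ∈ B w, ∃ y ∈ B w', G.Adj x y)

/-- The clique contraction number `ccl(G)` of a finite graph: the largest `k` such that the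
complete graph on `k` vertices is a minor of `G`. -/
noncomputable def cliqueContractionNumber {V : Type*} (G : SimpleGraph V) : ℕ :=
  sSup {k : ℕ | HasMinor G (⊤ : SimpleGraph (Fin k))}

/-- For a finite graph the supremum in the definition of `ccl(G)` is a maximum. -/
theorem isGreatest_cliqueContractionNumber {V : Type*} [Finite V] (G : SimpleGraph V) :
    IsGreatest {k : ℕ | HasMinor G (⊤ : SimpleGraph (Fin k))} (cliqueContractionNumber G) := by
  have hne : {k : ℕ | HasMinor G (⊤ : SimpleGraph (Fin k))}.Nonempty :=
    ⟨0, fun i => i.elim0, fun i => i.elim0, fun i => i.elim0, fun i => i.elim0⟩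
  have hb : BddAbove {k : ℕ | HasMinor G (⊤ : SimpleGraph (Fin k))} := by
    refine ⟨Nat.card V, ?_⟩
    rintro k ⟨B, hconn, hdisj, -⟩
    have hx : ∀ i, ∃ x, x ∈ B i := fun i =>
      let ⟨x⟩ := (hconn i).nonempty
      ⟨x.1, x.2⟩
    choose f hf using hx
    have hinj : Function.Injective f := by
      intro i j hij
      by_contra hne
      exact Set.disjoint_left.mp (hdisj i j hne) (hf i) (hij ▸ hf j)
    simpa using Nat.card_le_card_of_injective f hinj
  exact ⟨Nat.sSup_mem hne hb, fun k hk => le_csSup hb hk⟩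

/-- The ratios `e_G(U, V \ U) / |U|` over all nonempty vertex sets `U` with `|U| ≤ |V| / 2`. Since
`U` and its complement are disjoint, each edge between them is counted exactly once as a pair
in `G.interedges U Uᶜ`. -/
def edgeBoundaryRatios {V : Type*} [Fintype V] [DecidableEq V] (G : SimpleGraph V)
    [DecidableRel G.Adj] : Set ℝ :=
  {r : ℝ | ∃ U : Finset V, U.Nonempty ∧ 2 * U.card ≤ Fintype.card V ∧
    r = ((G.interedges U Uᶜ).card : ℝ) / (U.card : ℝ)}

/-- The edge isoperimetric number `i(G)` of a finite graph: the minimum of `e_G(U, V \ U) / |U|`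
over all nonempty `U` with `|U| ≤ |V| / 2` (for graphs on at least two vertices). -/
noncomputable def edgeIsoperimetricNumber {V : Type*} [Fintype V] [DecidableEq V]
    (G : SimpleGraph V) [DecidableRel G.Adj] : ℝ :=
  sInf (edgeBoundaryRatios G)

/-- On at least two vertices the infimum in the definition of `i(G)` is a minimum. -/
theorem isLeast_edgeIsoperimetricNumber {V : Type*} [Fintype V] [DecidableEq V]
    (G : SimpleGraph V) [DecidableRel G.Adj] (hV : 2 ≤ Fintype.card V) :
    IsLeast (edgeBoundaryRatios G) (edgeIsoperimetricNumber G) := by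
  have hfin : (edgeBoundaryRatios G).Finite := by
    refine (Set.finite_range (fun U : Finset V =>
      ((G.interedges U Uᶜ).card : ℝ) / (U.card : ℝ))).subset ?_
    rintro r ⟨U, -, -, rfl⟩
    exact ⟨U, rfl⟩
  have hne : (edgeBoundaryRatios G).Nonempty := by
    obtain ⟨v⟩ : Nonempty V := Fintype.card_pos_iff.mp (by omega)
    exact ⟨_, {v}, Finset.singleton_nonempty v, by simpa using hV, rfl⟩
  exact ⟨hne.csInf_mem hfin, fun r hr => csInf_le hfin.bddBelow hr⟩

/-! The clique model is grown one branch set at a time, each of size `L` of order `√n`. A set `A` of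
discarded vertices sends few edges to the unused set `W`. Take a state that maximises `A` first and
the number of branch sets second. Expansion of `G` keeps `A` small (`IsPartialModel.mul_card_le`).
By maximality `W` itself expands and every branch set has many edges into `W`, since otherwise the
offending part of `W`, or the branch set, could be discarded. Each branch set therefore has at least
`β L` neighbours in `W`, and it remains to find in `W` a connected set of size `L` meeting all these
neighbourhoods: it would be a further branch set.

That set comes from a lazy random walk of length of order `k` (`exists_connected_meeting`). Making
the walk hit every target outright would cost a logarithm. Instead, balls around a target grow at
least linearly in their radius `r`, so the walk misses the `r`-ball with probability about `2 ^
(-r)`. Its expected distance to each target is then bounded, and all targets can be attached by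
paths of total length `O(k)`.

The estimate for missing a set (`sum_avoidProb_le`) follows from expansion through the chain
co-area, Cheeger, Faber–Krahn. The walk is made deterministic by conditional expectations
(`exists_connected_card_disjoint_le`). -/

/-! ### Functional inequalities from edge expansion -/

open Finset in
/-- Discrete co-area inequality: a cut expansion bound for sets controls the total variation of
nonnegative functions with small support. -/
theorem coarea_le {V : Type*} [Fintype V] [DecidableEq V] {a : V → V → ℝ}
    (hs : ∀ u v, a u v = a v u) {κ : ℝ}
    (hexp : ∀ S : Finset V, S.Nonempty → 2 * S.card ≤ Fintype.card V →
      κ * S.card ≤ ∑ u ∈ S, ∑ v ∈ Sᶜ, a u v) :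
    ∀ (F : V → ℝ), (∀ v, 0 ≤ F v) → 2 * (univ.filter fun v => F v ≠ 0).card ≤ Fintype.card V →
      2 * κ * ∑ v, F v ≤ ∑ u, ∑ v, a u v * |F u - F v| := by
  suffices H : ∀ (m : ℕ) (F : V → ℝ), (univ.filter fun v => F v ≠ 0).card = m → (∀ v, 0 ≤ F v) →
      2 * (univ.filter fun v => F v ≠ 0).card ≤ Fintype.card V →
      2 * κ * ∑ v, F v ≤ ∑ u, ∑ v, a u v * |F u - F v| from fun F => H _ F rfl
  intro m
  induction m using Nat.strong_induction_on with
  | _ m ih =>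
  intro F hm hF hsupp
  set S := univ.filter fun v => F v ≠ 0 with hS
  have hSm : ∀ v, v ∈ S ↔ F v ≠ 0 := fun v => by simp [hS]
  rcases S.eq_empty_or_nonempty with he | hne
  · have hz : ∀ v, F v = 0 := fun v => by
      by_contra h
      have := (hSm v).2 h
      simp [he] at this
    simp [hz]
  obtain ⟨v₀, hv₀, hmin⟩ := S.exists_min_image F hne
  set μ := F v₀ with hμ
  have hμ0 : 0 ≤ μ := hF v₀
  -- Lowering `F` by its least positive value removes `v₀` from the support. Only pairs crossing the
  -- boundary of `S` lose variation, `μ` each in both orders, which the expansion of `S` pays for.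
  set F' : V → ℝ := fun v => if v ∈ S then F v - μ else 0 with hF'
  have hsub : (univ.filter fun v => F' v ≠ 0) ⊆ S.erase v₀ := by
    intro v hv
    have hv : F' v ≠ 0 := by simpa using hv
    by_cases hvS : v ∈ S
    · refine mem_erase.2 ⟨?_, hvS⟩
      rintro rfl
      simp [hF', hvS, hμ] at hv
    · simp [hF', hvS] at hv
  have hlt : (univ.filter fun v => F' v ≠ 0).card < S.card :=
    (card_le_card hsub).trans_lt (card_erase_lt_of_mem hv₀)
  have hF'0 : ∀ v, 0 ≤ F' v := fun v => by
    by_cases hvS : v ∈ S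
    · simpa [hF', hvS] using hmin v hvS
    · simp [hF', hvS]
  have key := ih _ (hm ▸ hlt) F' rfl hF'0 (by omega)
  have hsum : ∑ v, F v = ∑ v, F' v + μ * S.card := by
    have : ∀ v, F v = F' v + if v ∈ S then μ else 0 := fun v => by
      by_cases hvS : v ∈ S
      · simp [hF', hvS]
      · have : F v = 0 := by simpa using (hSm v).not.1 hvS
        simp [hF', hvS, this]
    rw [sum_congr rfl fun v _ => this v, sum_add_distrib]
    simp [mul_comm]
  have hpt : ∀ u v, a u v * |F u - F v| = a u v * |F' u - F' v| +
      μ * ((if u ∈ S then (if v ∈ Sᶜ then a u v else 0) else 0) +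
        (if v ∈ S then (if u ∈ Sᶜ then a v u else 0) else 0)) := fun u v => by
    rw [hs v u]
    by_cases hu : u ∈ S <;> by_cases hv : v ∈ S <;> simp only [hF', hu, hv, mem_compl, if_true,
      if_false, not_true, not_false_iff]
    · ring_nf
    · have h1 : F v = 0 := by simpa using (hSm v).not.1 hv
      have h2 := hmin u hu
      rw [h1, abs_of_nonneg (by linarith), abs_of_nonneg (by linarith)]
      ring
    · have h1 : F u = 0 := by simpa using (hSm u).not.1 hu
      have h2 := hmin v hv
      rw [h1, abs_of_nonpos (by linarith), abs_of_nonpos (by linarith)]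
      ring
    · have h1 : F u = 0 := by simpa using (hSm u).not.1 hu
      have h2 : F v = 0 := by simpa using (hSm v).not.1 hv
      simp [h1, h2]
  have hcut : ∑ u, ∑ v, (if u ∈ S then (if v ∈ Sᶜ then a u v else 0) else 0) =
      ∑ u ∈ S, ∑ v ∈ Sᶜ, a u v := by
    rw [← sum_filter_add_sum_filter_not univ (· ∈ S)]
    have : ∀ u, u ∉ S → ∑ v, (if u ∈ S then (if v ∈ Sᶜ then a u v else 0) else 0) = 0 :=
      fun u hu => by simp [hu]
    rw [sum_eq_zero (s := univ.filter fun u => u ∉ S) fun u hu => this u (by simpa using hu),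
      add_zero, filter_mem_eq_inter, univ_inter]
    refine sum_congr rfl fun u hu => ?_
    simp only [hu, if_true]
    rw [← sum_filter, filter_mem_eq_inter, univ_inter]
  have hcut' : ∑ u, ∑ v, (if v ∈ S then (if u ∈ Sᶜ then a v u else 0) else 0) =
      ∑ u ∈ S, ∑ v ∈ Sᶜ, a u v := by rw [sum_comm, hcut]
  have hsum2 : ∑ u, ∑ v, a u v * |F u - F v| = ∑ u, ∑ v, a u v * |F' u - F' v| +
      μ * (2 * ∑ u ∈ S, ∑ v ∈ Sᶜ, a u v) := by
    simp_rw [hpt, sum_add_distrib, ← mul_sum, sum_add_distrib]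
    rw [hcut, hcut']
    ring
  have hE := mul_le_mul_of_nonneg_left (hexp S hne hsupp) hμ0
  rw [hsum, hsum2]
  linarith

open Finset in
/-- Cheeger's inequality for nonnegative functions with small support. -/
theorem cheeger_le {V : Type*} [Fintype V] [DecidableEq V] {a : V → V → ℝ}
    (hs : ∀ u v, a u v = a v u) (h0 : ∀ u v, 0 ≤ a u v) {D β : ℝ} (hβ : 0 ≤ β)
    (hdeg : ∀ u, ∑ v, a u v ≤ D)
    (hexp : ∀ S : Finset V, S.Nonempty → 2 * S.card ≤ Fintype.card V →
      β * D * S.card ≤ ∑ u ∈ S, ∑ v ∈ Sᶜ, a u v)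
    (h : V → ℝ) (hh : ∀ v, 0 ≤ h v)
    (hsupp : 2 * (univ.filter fun v => h v ≠ 0).card ≤ Fintype.card V) :
    β ^ 2 * D * ∑ v, h v ^ 2 ≤ ∑ u, ∑ v, a u v * (h u - h v) ^ 2 := by
  have h1 := coarea_le hs hexp (fun v => h v ^ 2) (fun v => sq_nonneg _) (by simpa using hsupp)
  have hdegsum : ∑ u, ∑ v, a u v * h u ^ 2 ≤ D * ∑ v, h v ^ 2 := by
    rw [mul_sum]
    refine sum_le_sum fun u _ => ?_
    rw [← sum_mul]
    exact mul_le_mul_of_nonneg_right (hdeg u) (sq_nonneg _)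
  have hdegsum' : ∑ u, ∑ v, a u v * h v ^ 2 ≤ D * ∑ v, h v ^ 2 := by
    rw [sum_comm]
    simp_rw [fun u v => hs u v]
    exact hdegsum
  rcases hβ.eq_or_lt with rfl | hβ
  · simpa using sum_nonneg fun u _ => sum_nonneg fun v _ => mul_nonneg (h0 u v) (sq_nonneg _)
  -- Weighted AM-GM replaces Cauchy–Schwarz. The weights make the second term sum to at most `β * D
  -- * ∑ h²`, half of the left side of the co-area bound.
  have hpt : ∀ u v, a u v * |h u ^ 2 - h v ^ 2| ≤
      β⁻¹ * (a u v * (h u - h v) ^ 2) + (β / 2) * (a u v * h u ^ 2 + a u v * h v ^ 2) := fun u v => by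
    have e : |h u ^ 2 - h v ^ 2| = |h u - h v| * (h u + h v) := by
      rw [sq_sub_sq, abs_mul, abs_of_nonneg (add_nonneg (hh u) (hh v)), mul_comm]
    have k1 : |h u - h v| * (h u + h v) ≤ β⁻¹ * |h u - h v| ^ 2 + β / 4 * (h u + h v) ^ 2 := by
      have : 0 ≤ β⁻¹ * (|h u - h v| - β / 2 * (h u + h v)) ^ 2 := by positivity
      have e2 : β⁻¹ * (|h u - h v| - β / 2 * (h u + h v)) ^ 2 =
        β⁻¹ * |h u - h v| ^ 2 + β / 4 * (h u + h v) ^ 2 - |h u - h v| * (h u + h v) := by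
        field_simp
        ring
      linarith
    have k2 : (h u + h v) ^ 2 ≤ 2 * (h u ^ 2 + h v ^ 2) := add_sq_le
    rw [sq_abs] at k1
    have k3 : |h u ^ 2 - h v ^ 2| ≤ β⁻¹ * (h u - h v) ^ 2 + β / 2 * (h u ^ 2 + h v ^ 2) := by
      rw [e]; nlinarith
    calc _ ≤ a u v * (β⁻¹ * (h u - h v) ^ 2 + β / 2 * (h u ^ 2 + h v ^ 2)) :=
          mul_le_mul_of_nonneg_left k3 (h0 u v)
      _ = _ := by ring
  have h2 : ∑ u, ∑ v, a u v * |h u ^ 2 - h v ^ 2| ≤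
      β⁻¹ * (∑ u, ∑ v, a u v * (h u - h v) ^ 2) +
        (β / 2) * (∑ u, ∑ v, a u v * h u ^ 2 + ∑ u, ∑ v, a u v * h v ^ 2) := by
    refine (sum_le_sum fun u _ => sum_le_sum fun v _ => hpt u v).trans_eq ?_
    simp_rw [sum_add_distrib, ← mul_sum, sum_add_distrib]
  have h3 : β * D * ∑ v, h v ^ 2 ≤ β⁻¹ * (∑ u, ∑ v, a u v * (h u - h v) ^ 2) := by
    nlinarith
  have h4 := mul_le_mul_of_nonneg_left h3 hβ.le
  rw [← mul_assoc β β⁻¹, mul_inv_cancel₀ hβ.ne', one_mul] at h4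
  linarith

open Finset in
/-- Every real function on a finite nonempty type has a median. -/
theorem exists_median {V : Type*} [Fintype V] [DecidableEq V] [Nonempty V] (f : V → ℝ) :
    ∃ m : ℝ, 2 * (univ.filter fun v => m < f v).card ≤ Fintype.card V ∧
      2 * (univ.filter fun v => f v < m).card ≤ Fintype.card V := by
  -- The median is the least value of `f` with at most half of the vertices strictly above it.
  have hne : (univ.filter fun w : V =>
      2 * (univ.filter fun v => f w < f v).card ≤ Fintype.card V).Nonempty := by
    obtain ⟨w, -, hw⟩ := univ.exists_max_image f (univ_nonempty (α := V))
    refine ⟨w, ?_⟩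
    have : (univ.filter fun v => f w < f v) = ∅ := by
      ext v; simpa using hw v (mem_univ v)
    simp [this]
  obtain ⟨w, hw, hmin⟩ := exists_min_image _ f hne
  refine ⟨f w, by simpa using hw, ?_⟩
  rcases (univ.filter fun v => f v < f w).eq_empty_or_nonempty with he | hne'
  · simp [he]
  obtain ⟨x, hx, hmax⟩ := exists_max_image _ f hne'
  have hx' : f x < f w := by simpa using hx
  have hbig : Fintype.card V < 2 * (univ.filter fun v => f x < f v).card := by
    by_contra hcon
    have := hmin x (by simpa using hcon)
    linarith
  have heq : (univ.filter fun v => f v < f w) = (univ.filter fun v => f x < f v)ᶜ := by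
    ext v
    simp only [mem_filter, mem_univ, true_and, mem_compl, not_lt]
    exact ⟨fun h => hmax v (by simpa using h), fun h => h.trans_lt hx'⟩
  rw [heq, card_compl]
  have := card_le_univ (univ.filter fun v => f x < f v)
  omega

open Finset in
/-- Faber–Krahn inequality: functions vanishing on `U` have Dirichlet energy proportional to
`|U| / |V|`. -/
theorem faber_krahn_le {V : Type*} [Fintype V] [DecidableEq V] {a : V → V → ℝ}
    (hs : ∀ u v, a u v = a v u) (h0 : ∀ u v, 0 ≤ a u v) {D β : ℝ} (hD : 0 < D) (hβ : 0 ≤ β)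
    (hdeg : ∀ u, ∑ v, a u v ≤ D)
    (hexp : ∀ S : Finset V, S.Nonempty → 2 * S.card ≤ Fintype.card V →
      β * D * S.card ≤ ∑ u ∈ S, ∑ v ∈ Sᶜ, a u v)
    (U : Finset V) (f : V → ℝ) (hf : ∀ v ∈ U, f v = 0) :
    β ^ 2 * D * (U.card / (4 * Fintype.card V)) * ∑ v, f v ^ 2 ≤
      ∑ u, ∑ v, a u v * (f u - f v) ^ 2 := by
  rcases isEmpty_or_nonempty V with hV | hV
  · simp
  -- The positive and negative parts of `f - m` are each supported on at most half of the vertices,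
  -- so Cheeger applies to both.
  obtain ⟨m, hm1, hm2⟩ := exists_median f
  have hcard : (0 : ℝ) < Fintype.card V := by exact_mod_cast Fintype.card_pos
  have c1 := cheeger_le hs h0 hβ hdeg hexp (fun v => max (f v - m) 0) (fun v => le_max_right _ _)
    (by
      refine le_trans (Nat.mul_le_mul_left 2 (card_le_card fun v hv => ?_)) hm1
      simp only [mem_filter, mem_univ, true_and, ne_eq, max_eq_right_iff, not_le] at hv ⊢
      linarith)
  have c2 := cheeger_le hs h0 hβ hdeg hexp (fun v => max (m - f v) 0) (fun v => le_max_right _ _)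
    (by
      refine le_trans (Nat.mul_le_mul_left 2 (card_le_card fun v hv => ?_)) hm2
      simp only [mem_filter, mem_univ, true_and, ne_eq, max_eq_right_iff, not_le] at hv ⊢
      linarith)
  have hmax : ∀ x : ℝ, max x 0 ^ 2 + max (-x) 0 ^ 2 = x ^ 2 := fun x => by
    rcases le_total 0 x with h | h
    · rw [max_eq_left h, max_eq_right (by linarith)]; ring
    · rw [max_eq_right h, max_eq_left (by linarith)]; ring
  have hmax2 : ∀ x y : ℝ, (max x 0 - max y 0) ^ 2 + (max (-x) 0 - max (-y) 0) ^ 2 ≤ (x - y) ^ 2 :=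
    fun x y => by
    rcases le_total 0 x with h | h <;> rcases le_total 0 y with h' | h'
    · rw [max_eq_left h, max_eq_left h', max_eq_right (by linarith), max_eq_right (by linarith)]
      linarith
    · rw [max_eq_left h, max_eq_right h', max_eq_right (by linarith), max_eq_left (by linarith)]
      nlinarith
    · rw [max_eq_right h, max_eq_left h', max_eq_left (by linarith), max_eq_right (by linarith)]
      nlinarith
    · rw [max_eq_right h, max_eq_right h', max_eq_left (by linarith), max_eq_left (by linarith)]
      linarith
  have e1 : ∑ v, max (f v - m) 0 ^ 2 + ∑ v, max (m - f v) 0 ^ 2 = ∑ v, (f v - m) ^ 2 := by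
    rw [← sum_add_distrib]
    refine sum_congr rfl fun v _ => ?_
    rw [← hmax (f v - m), neg_sub]
  have e2 : ∑ u, ∑ v, a u v * (max (f u - m) 0 - max (f v - m) 0) ^ 2 +
      ∑ u, ∑ v, a u v * (max (m - f u) 0 - max (m - f v) 0) ^ 2 ≤
      ∑ u, ∑ v, a u v * (f u - f v) ^ 2 := by
    simp_rw [← sum_add_distrib, ← mul_add]
    refine sum_le_sum fun u _ => sum_le_sum fun v _ => mul_le_mul_of_nonneg_left ?_ (h0 u v)
    have := hmax2 (f u - m) (f v - m)
    simpa only [neg_sub, sub_sub_sub_cancel_right] using this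
  have e3 : β ^ 2 * D * ∑ v, (f v - m) ^ 2 ≤ ∑ u, ∑ v, a u v * (f u - f v) ^ 2 := by
    rw [← e1]; linarith
  -- Vanishing on `U` bounds the median, so returning from `f - m` to `f` costs only a factor `4 |V|
  -- / |U|`.
  have e4 : U.card * m ^ 2 ≤ ∑ v, (f v - m) ^ 2 := by
    calc U.card * m ^ 2 = ∑ v ∈ U, (f v - m) ^ 2 := by
          rw [sum_congr rfl fun v hv => by rw [hf v hv, zero_sub, neg_sq]]
          simp
      _ ≤ _ := sum_le_sum_of_subset_of_nonneg (subset_univ _) fun _ _ _ => sq_nonneg _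
  have e5 : ∑ v, f v ^ 2 ≤ 2 * ∑ v, (f v - m) ^ 2 + 2 * (Fintype.card V * m ^ 2) := by
    calc ∑ v, f v ^ 2 ≤ ∑ v, (2 * (f v - m) ^ 2 + 2 * m ^ 2) :=
          sum_le_sum fun v _ => by nlinarith [sq_nonneg (f v - m - m)]
      _ = _ := by
          rw [sum_add_distrib, ← mul_sum]
          simp
          ring
  have hU : (U.card : ℝ) ≤ Fintype.card V := by exact_mod_cast card_le_univ U
  have e6 : (U.card / (4 * Fintype.card V) : ℝ) * ∑ v, f v ^ 2 ≤ ∑ v, (f v - m) ^ 2 := by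
    rw [div_mul_eq_mul_div, div_le_iff₀ (by positivity)]
    have hX : 0 ≤ ∑ v, (f v - m) ^ 2 := sum_nonneg fun _ _ => sq_nonneg _
    have k1 := mul_le_mul_of_nonneg_left e5 (Nat.cast_nonneg (α := ℝ) U.card)
    have k2 := mul_le_mul_of_nonneg_right hU hX
    have k3 := mul_le_mul_of_nonneg_left e4 hcard.le
    nlinarith
  calc _ = β ^ 2 * D * ((U.card / (4 * Fintype.card V)) * ∑ v, f v ^ 2) := by ring
    _ ≤ β ^ 2 * D * ∑ v, (f v - m) ^ 2 := mul_le_mul_of_nonneg_left e6 (by positivity)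
    _ ≤ _ := e3

/-! ### The lazy walk and its avoidance probabilities -/

/-- The lazy random walk operator with weights `a` and scale `D`. -/
noncomputable def lazyWalk {V : Type*} [Fintype V] (a : V → V → ℝ) (D : ℝ) (f : V → ℝ) : V → ℝ :=
  fun v => f v + (2 * D)⁻¹ * ∑ u, a v u * (f u - f v)

-- Summation by parts over ordered pairs. The right side is symmetric in `f` and `g`, so the walk
-- operator is self-adjoint.
open Finset in
theorem sum_mul_lazyWalk {V : Type*} [Fintype V] {a : V → V → ℝ}
    (hs : ∀ u v, a u v = a v u) {D : ℝ} (f g : V → ℝ) :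
    ∑ v, f v * lazyWalk a D g v =
      ∑ v, f v * g v - (4 * D)⁻¹ * ∑ u, ∑ v, a u v * ((f u - f v) * (g u - g v)) := by
  have e1 : ∑ v, f v * lazyWalk a D g v =
      ∑ v, f v * g v + (2 * D)⁻¹ * ∑ v, ∑ u, a v u * (f v * (g u - g v)) := by
    simp_rw [lazyWalk, mul_add, sum_add_distrib]
    congr 1
    rw [mul_sum]
    refine sum_congr rfl fun v _ => ?_
    rw [mul_left_comm, mul_sum]
    congr 1
    exact sum_congr rfl fun u _ => by ring
  have e2 : ∑ v, ∑ u, a v u * (f v * (g u - g v)) = ∑ v, ∑ u, a v u * (f u * (g v - g u)) := by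
    rw [sum_comm]
    exact sum_congr rfl fun u _ => sum_congr rfl fun v _ => by rw [hs u v]
  have e3 : ∑ u, ∑ v, a u v * ((f u - f v) * (g u - g v)) =
      -(∑ v, ∑ u, a v u * (f v * (g u - g v)) + ∑ v, ∑ u, a v u * (f u * (g v - g u))) := by
    rw [← sum_add_distrib, ← sum_neg_distrib]
    refine sum_congr rfl fun u _ => ?_
    rw [← sum_add_distrib, ← sum_neg_distrib]
    exact sum_congr rfl fun v _ => by ring
  rw [e1, e3, ← e2, show (4 * D)⁻¹ = (2 * D)⁻¹ * 2⁻¹ by rw [← mul_inv]; ring_nf]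
  ring

-- Laziness gives positivity: `(x - y)² ≤ 2 x² + 2 y²` bounds the energy by `4 * D * ∑ f²`.
open Finset in
theorem sum_mul_lazyWalk_self_nonneg {V : Type*} [Fintype V] {a : V → V → ℝ}
    (hs : ∀ u v, a u v = a v u) (h0 : ∀ u v, 0 ≤ a u v) {D : ℝ} (hD : 0 < D)
    (hdeg : ∀ u, ∑ v, a u v ≤ D) (f : V → ℝ) : 0 ≤ ∑ v, f v * lazyWalk a D f v := by
  have h1 : ∑ u, ∑ v, a u v * f u ^ 2 ≤ D * ∑ v, f v ^ 2 := by
    rw [mul_sum]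
    refine sum_le_sum fun u _ => ?_
    rw [← sum_mul]
    exact mul_le_mul_of_nonneg_right (hdeg u) (sq_nonneg _)
  have h2 : ∑ u, ∑ v, a u v * f v ^ 2 ≤ D * ∑ v, f v ^ 2 := by
    rw [sum_comm]
    simp_rw [fun u v => hs u v]
    exact h1
  have h3 : ∑ u, ∑ v, a u v * ((f u - f v) * (f u - f v)) ≤
      2 * (∑ u, ∑ v, a u v * f u ^ 2 + ∑ u, ∑ v, a u v * f v ^ 2) := by
    simp_rw [← sum_add_distrib, mul_sum]
    refine sum_le_sum fun u _ => sum_le_sum fun v _ => ?_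
    nlinarith [mul_nonneg (h0 u v) (sq_nonneg (f u + f v))]
  rw [sum_mul_lazyWalk hs]
  have h4 : (4 * D)⁻¹ * ∑ u, ∑ v, a u v * ((f u - f v) * (f u - f v)) ≤ ∑ v, f v * f v := by
    rw [inv_mul_le_iff₀ (by positivity)]
    simp_rw [← pow_two (f _)]
    linarith
  linarith

/-- `avoidProb a D A t v` is the probability that the lazy walk started at `v` stays in `A` at
all times `0, …, t`. -/
noncomputable def avoidProb {V : Type*} [Fintype V] [DecidableEq V] (a : V → V → ℝ) (D : ℝ)
    (A : Finset V) : ℕ → V → ℝ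
  | 0 => fun v => if v ∈ A then 1 else 0
  | t + 1 => fun v => if v ∈ A then lazyWalk a D (avoidProb a D A t) v else 0

theorem avoidProb_of_notMem {V : Type*} [Fintype V] [DecidableEq V] (a : V → V → ℝ) (D : ℝ)
    (A : Finset V) (t : ℕ) {v : V} (hv : v ∉ A) : avoidProb a D A t v = 0 := by
  cases t <;> simp [avoidProb, hv]

open Finset in
/-- The probability that a stationary lazy walk avoids a set decays exponentially. -/
theorem sum_avoidProb_le {V : Type*} [Fintype V] [DecidableEq V] {a : V → V → ℝ}
    (hs : ∀ u v, a u v = a v u) (h0 : ∀ u v, 0 ≤ a u v) {D β : ℝ} (hD : 0 < D) (hβ : 0 ≤ β)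
    (hdeg : ∀ u, ∑ v, a u v ≤ D)
    (hexp : ∀ S : Finset V, S.Nonempty → 2 * S.card ≤ Fintype.card V →
      β * D * S.card ≤ ∑ u ∈ S, ∑ v ∈ Sᶜ, a u v)
    (U : Finset V) (t : ℕ) :
    ∑ v, avoidProb a D Uᶜ t v ≤
      Fintype.card V * Real.exp (-(β ^ 2 / 16 * (U.card / Fintype.card V) * t)) := by
  set x : ℝ := β ^ 2 / 16 * (U.card / Fintype.card V) with hx
  have hlam : 0 < Real.exp (-x) := Real.exp_pos _
  have hform : ∀ f : V → ℝ, (∀ v ∈ U, f v = 0) →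
      ∑ v, f v * lazyWalk a D f v ≤ Real.exp (-x) * ∑ v, f v ^ 2 := fun f hf => by
    have h1 := faber_krahn_le hs h0 hD hβ hdeg hexp U f hf
    rw [sum_mul_lazyWalk hs]
    simp_rw [← pow_two]
    -- The `16` is the `4` of Faber–Krahn times the `4` of the Dirichlet form.
    have h2 : x * ∑ v, f v ^ 2 ≤ (4 * D)⁻¹ * ∑ u, ∑ v, a u v * (f u - f v) ^ 2 := by
      refine le_trans (le_of_eq ?_) (mul_le_mul_of_nonneg_left h1 (by positivity))
      rw [hx, mul_inv]
      field_simp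
      ring
    have h3 := Real.add_one_le_exp (-x)
    have h4 := mul_le_mul_of_nonneg_right h3 (sum_nonneg fun v (_ : v ∈ univ) => sq_nonneg (f v))
    linarith
  have hstep : ∀ t, ∑ v, avoidProb a D Uᶜ (t + 1) v ^ 2 ≤
      Real.exp (-x) ^ 2 * ∑ v, avoidProb a D Uᶜ t v ^ 2 := fun t => by
    set g := avoidProb a D Uᶜ t with hg
    set g' := avoidProb a D Uᶜ (t + 1) with hg'
    have hgU : ∀ v ∈ U, g v = 0 := fun v hv => avoidProb_of_notMem _ _ _ _ (by simpa using hv)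
    have hgU' : ∀ v ∈ U, g' v = 0 := fun v hv => avoidProb_of_notMem _ _ _ _ (by simpa using hv)
    have e1 : ∑ v, g' v ^ 2 = ∑ v, g' v * lazyWalk a D g v := by
      refine sum_congr rfl fun v _ => ?_
      by_cases hv : v ∈ U
      · simp [hgU' v hv]
      · have : g' v = lazyWalk a D g v := by simp [hg', avoidProb, hv, hg]
        rw [this, pow_two]
    set l := Real.exp (-x) with hl
    -- With `P` the walk operator, positivity at `g' - l g` gives `2 l ⟨g', P g⟩ ≤ ⟨g', P g'⟩ + l²
    -- ⟨g, P g⟩`. As `⟨g', P g⟩ = ‖g'‖²`, the bound `hform` on both right-hand terms yields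
    -- contraction by `l` without diagonalising.
    have h1 := sum_mul_lazyWalk_self_nonneg hs h0 hD hdeg (fun v => g' v - l * g v)
    have e2 : ∑ v, (g' v - l * g v) * lazyWalk a D (fun v => g' v - l * g v) v =
        ∑ v, g' v * lazyWalk a D g' v - 2 * l * ∑ v, g' v * lazyWalk a D g v +
          l ^ 2 * ∑ v, g v * lazyWalk a D g v := by
      have hlin : ∀ v, lazyWalk a D (fun v => g' v - l * g v) v =
          lazyWalk a D g' v - l * lazyWalk a D g v := fun v => by
        have : ∑ u, a v u * (g' u - l * g u - (g' v - l * g v)) =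
            ∑ u, a v u * (g' u - g' v) - l * ∑ u, a v u * (g u - g v) := by
          rw [mul_sum, ← sum_sub_distrib]
          exact sum_congr rfl fun u _ => by ring
        simp only [lazyWalk, this]
        ring
      have hsym : ∑ v, g v * lazyWalk a D g' v = ∑ v, g' v * lazyWalk a D g v := by
        rw [sum_mul_lazyWalk hs, sum_mul_lazyWalk hs]
        simp_rw [mul_comm (g _) (g' _), mul_comm (g _ - g _)]
      have : ∀ v, (g' v - l * g v) * lazyWalk a D (fun v => g' v - l * g v) v =
          g' v * lazyWalk a D g' v - l * (g' v * lazyWalk a D g v) -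
            l * (g v * lazyWalk a D g' v) + l ^ 2 * (g v * lazyWalk a D g v) := fun v => by
        rw [hlin]; ring
      rw [sum_congr rfl fun v _ => this v, sum_add_distrib, sum_sub_distrib, sum_sub_distrib,
        ← mul_sum, ← mul_sum, ← mul_sum, hsym]
      ring
    rw [e2, ← e1] at h1
    have h2 := hform g' hgU'
    have h3 := mul_le_mul_of_nonneg_left (hform g hgU) (sq_nonneg l)
    have h4 : l * ∑ v, g' v ^ 2 ≤ l * (l ^ 2 * ∑ v, g v ^ 2) := by nlinarith
    exact le_of_mul_le_mul_left h4 hlam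
  have hsq : ∀ t, ∑ v, avoidProb a D Uᶜ t v ^ 2 ≤ (Real.exp (-x) ^ t) ^ 2 * Fintype.card V := by
    intro t
    induction t with
    | zero =>
      have : ∀ v, avoidProb a D Uᶜ 0 v ^ 2 ≤ 1 := fun v => by
        simp only [avoidProb]; split_ifs <;> simp
      refine (sum_le_sum fun v _ => this v).trans ?_
      simp
    | succ t ih =>
      refine (hstep t).trans ?_
      refine (mul_le_mul_of_nonneg_left ih (by positivity)).trans_eq ?_
      ring
  have h5 : (∑ v, avoidProb a D Uᶜ t v) ^ 2 ≤ (Fintype.card V * Real.exp (-x) ^ t) ^ 2 := by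
    refine (sq_sum_le_card_mul_sum_sq (s := univ) (f := avoidProb a D Uᶜ t)).trans ?_
    refine (mul_le_mul_of_nonneg_left (hsq t) (Nat.cast_nonneg _)).trans_eq ?_
    rw [card_univ]
    ring
  have h6 := abs_le_of_sq_le_sq h5 (by positivity)
  rw [show -(x * t) = t * (-x) by ring, Real.exp_nat_mul]
  exact (le_abs_self _).trans h6

/-! ### Edge counts, and connected sets traced by walks -/

/-- The `0`-`1` adjacency weights of a graph. -/
def adjWeight {V : Type*} (G : SimpleGraph V) [DecidableRel G.Adj] (u v : V) : ℝ :=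
  if G.Adj u v then 1 else 0

theorem adjWeight_nonneg {V : Type*} (G : SimpleGraph V) [DecidableRel G.Adj] (u v : V) :
    0 ≤ adjWeight G u v := by
  unfold adjWeight; split_ifs <;> simp

theorem adjWeight_comm {V : Type*} (G : SimpleGraph V) [DecidableRel G.Adj] (u v : V) :
    adjWeight G u v = adjWeight G v u := by
  simp [adjWeight, G.adj_comm]

open Finset in
theorem sum_adjWeight {V : Type*} [Fintype V] (G : SimpleGraph V) [DecidableRel G.Adj] (v : V) :
    ∑ u, adjWeight G v u = G.degree v := by
  simp only [adjWeight]
  rw [sum_boole, ← SimpleGraph.card_neighborFinset_eq_degree, SimpleGraph.neighborFinset_eq_filter]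

open Finset in
theorem card_interedges_eq_sum {V : Type*} (G : SimpleGraph V) [DecidableRel G.Adj]
    (S T : Finset V) : ((G.interedges S T).card : ℝ) = ∑ u ∈ S, ∑ v ∈ T, adjWeight G u v := by
  simp only [SimpleGraph.interedges, Rel.interedges, card_filter, sum_product, adjWeight]
  push_cast
  rfl

-- A vertex of `T` absorbs at most `D` edges; this turns edge expansion into vertex expansion.
open Finset in
theorem card_interedges_le_mul_card_neighbors {V : Type*} [Fintype V] (G : SimpleGraph V)
    [DecidableRel G.Adj] {D : ℝ} (hdeg : ∀ v, (G.degree v : ℝ) ≤ D) (S T : Finset V) :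
    ((G.interedges S T).card : ℝ) ≤ D * (T.filter fun y => ∃ x ∈ S, G.Adj x y).card := by
  rw [card_interedges_eq_sum, sum_comm, ← sum_filter_add_sum_filter_not T (∃ x ∈ S, G.Adj x ·)]
  have h1 : ∑ y ∈ T with ¬∃ x ∈ S, G.Adj x y, ∑ x ∈ S, adjWeight G x y = 0 :=
    sum_eq_zero fun y hy => sum_eq_zero fun x hx => by
      have h2 : ¬ G.Adj x y := fun h => (mem_filter.1 hy).2 ⟨x, hx, h⟩
      simp [adjWeight, h2]
  rw [h1, add_zero, mul_comm D, ← nsmul_eq_mul]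
  refine sum_le_card_nsmul _ _ _ fun y _ => ?_
  refine le_trans ?_ (hdeg y)
  rw [← sum_adjWeight]
  simp_rw [fun x => adjWeight_comm G y x]
  exact sum_le_sum_of_subset_of_nonneg (subset_univ _) fun _ _ _ => adjWeight_nonneg G _ _

open Finset in
theorem card_interedges_le_mul_card_right {V : Type*} [Fintype V] (G : SimpleGraph V)
    [DecidableRel G.Adj] {D : ℝ} (hD : 0 ≤ D) (hdeg : ∀ v, (G.degree v : ℝ) ≤ D)
    (S T : Finset V) : ((G.interedges S T).card : ℝ) ≤ D * T.card :=
  (card_interedges_le_mul_card_neighbors G hdeg S T).trans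
    (mul_le_mul_of_nonneg_left (by exact_mod_cast card_filter_le _ _) hD)

theorem induce_insert_connected {V : Type*} [DecidableEq V] {G : SimpleGraph V} {R : Finset V}
    {u v : V} (hR : (G.induce (R : Set V)).Connected) (hu : u ∈ R) (huv : v = u ∨ G.Adj v u) :
    (G.induce ((insert v R : Finset V) : Set V)).Connected := by
  rcases huv with rfl | h
  · rwa [Finset.insert_eq_of_mem hu]
  · have h1 := SimpleGraph.induce_union_connected
      (SimpleGraph.induce_pair_connected_of_adj h).preconnected hR.preconnected
      ⟨u, by simp, by simpa using hu⟩
    have h2 : ({v, u} ∪ (R : Set V)) = ((insert v R : Finset V) : Set V) := by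
      ext x
      simp only [Set.mem_union, Set.mem_insert_iff, Set.mem_singleton_iff, Finset.mem_coe,
        Finset.coe_insert]
      constructor
      · rintro ((rfl | rfl) | h)
        · exact Or.inl rfl
        · exact Or.inr hu
        · exact Or.inr h
      · rintro (rfl | h)
        · exact Or.inl (Or.inl rfl)
        · exact Or.inr h
    rwa [← h2]

open Finset in
/-- Some lazy step does not increase a function above its average after one step. -/
theorem exists_step_le_lazyWalk {V : Type*} [Fintype V] (G : SimpleGraph V) [DecidableRel G.Adj]
    {D : ℝ} (hD : 0 < D) (hdeg : ∀ v, (G.degree v : ℝ) ≤ D) (f : V → ℝ) (v : V) :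
    ∃ u, (v = u ∨ G.Adj v u) ∧ f u ≤ lazyWalk (adjWeight G) D f v := by
  by_contra! hcon
  set c := lazyWalk (adjWeight G) D f v with hc
  have hv := hcon v (Or.inl rfl)
  have h1 : ∑ u, adjWeight G v u * (c - f v) ≤ ∑ u, adjWeight G v u * (f u - f v) :=
    sum_le_sum fun u _ => by
      by_cases h : G.Adj v u
      · have := hcon u (Or.inr h)
        exact mul_le_mul_of_nonneg_left (by linarith) (adjWeight_nonneg G v u)
      · simp [adjWeight, h]
  rw [← sum_mul, sum_adjWeight] at h1
  -- Here `c - f v < 0`, so a degree below `D`, which only makes the walk lazier, goes the right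
  -- way.
  have h2 : D * (c - f v) ≤ G.degree v * (c - f v) :=
    mul_le_mul_of_nonpos_right (hdeg v) (by linarith)
  have h3 : (2 * D)⁻¹ * (D * (c - f v)) ≤
      (2 * D)⁻¹ * ∑ u, adjWeight G v u * (f u - f v) :=
    mul_le_mul_of_nonneg_left (h2.trans h1) (by positivity)
  have h4 : (2 * D)⁻¹ * (D * (c - f v)) = (c - f v) / 2 := by field_simp
  have h5 : c = f v + (2 * D)⁻¹ * ∑ u, adjWeight G v u * (f u - f v) := rfl
  linarith

open Finset in
/-- The method of conditional expectations for the lazy walk: some walk avoids at most the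
expected number of the given sets. -/
theorem exists_connected_card_disjoint_le {V ι : Type*} [Fintype V] [DecidableEq V]
    (G : SimpleGraph V) [DecidableRel G.Adj] {D : ℝ} (hD : 0 < D)
    (hdeg : ∀ v, (G.degree v : ℝ) ≤ D) (U : ι → Finset V) (t : ℕ) :
    ∀ (J : Finset ι) (v : V), ∃ R : Finset V, v ∈ R ∧ R.card ≤ t + 1 ∧
      (G.induce (R : Set V)).Connected ∧
      ((J.filter fun j => Disjoint R (U j)).card : ℝ) ≤
        ∑ j ∈ J, avoidProb (adjWeight G) D (U j)ᶜ t v := by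
  induction t with
  | zero =>
    refine fun J v => ⟨{v}, by simp, by simp, ?_, ?_⟩
    · rw [coe_singleton]
      have : Nonempty ({v} : Set V) := ⟨⟨v, rfl⟩⟩
      exact ⟨SimpleGraph.Preconnected.of_subsingleton⟩
    · simp [avoidProb, card_filter]
  | succ t ih =>
    intro J v
    -- Sets containing `v` are already met; the next vertex is chosen so as not to raise the
    -- expected number missed among the rest.
    set J' := J.filter fun j => v ∉ U j with hJ'
    obtain ⟨u, hvu, hu⟩ := exists_step_le_lazyWalk G hD hdeg
      (fun x => ∑ j ∈ J', avoidProb (adjWeight G) D (U j)ᶜ t x) v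
    obtain ⟨R, huR, hcard, hconn, hR⟩ := ih J' u
    refine ⟨insert v R, mem_insert_self _ _, (card_insert_le _ _).trans (by omega),
      induce_insert_connected hconn huR hvu, ?_⟩
    have e1 : ∑ j ∈ J, avoidProb (adjWeight G) D (U j)ᶜ (t + 1) v =
        lazyWalk (adjWeight G) D (fun x => ∑ j ∈ J', avoidProb (adjWeight G) D (U j)ᶜ t x) v := by
      simp only [avoidProb, mem_compl]
      rw [← sum_filter, ← hJ']
      simp only [lazyWalk, ← sum_sub_distrib, mul_sum]
      rw [sum_add_distrib, sum_comm]
    rw [e1]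
    refine le_trans ?_ (hR.trans hu)
    refine Nat.cast_le.2 (card_le_card fun j hj => ?_)
    simp only [hJ', mem_filter, disjoint_insert_left] at hj ⊢
    tauto

/-! ### Balls, and a connected set meeting many targets -/

/-- The set of vertices at distance at most `r` from `U`. -/
def neighborhoodBall {V : Type*} [Fintype V] [DecidableEq V] (G : SimpleGraph V)
    [DecidableRel G.Adj] (U : Finset V) : ℕ → Finset V
  | 0 => U
  | r + 1 => neighborhoodBall G U r ∪
      Finset.univ.filter fun y => ∃ x ∈ neighborhoodBall G U r, G.Adj x y

theorem neighborhoodBall_mono {V : Type*} [Fintype V] [DecidableEq V] (G : SimpleGraph V)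
    [DecidableRel G.Adj] (U : Finset V) : Monotone (neighborhoodBall G U) :=
  monotone_nat_of_le_succ fun _ => Finset.subset_union_left

open Finset in
/-- Balls around a set grow at least linearly until they fill half of an expander. -/
theorem min_le_card_neighborhoodBall {V : Type*} [Fintype V] [DecidableEq V] (G : SimpleGraph V)
    [DecidableRel G.Adj] {D β s : ℝ} (hD : 0 < D) (hβ : 0 ≤ β)
    (hdeg : ∀ v, (G.degree v : ℝ) ≤ D)
    (hexp : ∀ S : Finset V, S.Nonempty → 2 * S.card ≤ Fintype.card V →
      β * D * S.card ≤ (G.interedges S Sᶜ).card)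
    {U : Finset V} (hU : s ≤ U.card) (r : ℕ) :
    min ((Fintype.card V : ℝ) / 2) (s * β * r) ≤ (neighborhoodBall G U r).card := by
  induction r with
  | zero => simp
  | succ r ih =>
    set B := neighborhoodBall G U r with hB
    have hsub : B ⊆ neighborhoodBall G U (r + 1) := neighborhoodBall_mono G U r.le_succ
    rcases le_or_gt (2 * B.card) (Fintype.card V) with h | h
    · rw [min_le_iff]
      have hBU : (U.card : ℝ) ≤ B.card := by
        exact_mod_cast card_le_card (neighborhoodBall_mono G U r.zero_le)
      have h1 : β * D * B.card ≤ (G.interedges B Bᶜ).card := by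
        rcases B.eq_empty_or_nonempty with he | hne
        · simp [he]
        · exact hexp B hne h
      have h2 := h1.trans (card_interedges_le_mul_card_neighbors G hdeg B Bᶜ)
      set N := Bᶜ.filter fun y => ∃ x ∈ B, G.Adj x y with hN
      have h3 : β * B.card ≤ N.card := by
        refine le_of_mul_le_mul_left ?_ hD
        linarith
      have h4 : (B.card : ℝ) + N.card ≤ (neighborhoodBall G U (r + 1)).card := by
        have hd : Disjoint B N := by
          rw [disjoint_left]
          intro x hx hx'
          simp [hN, hx] at hx'
        rw [← Nat.cast_add, ← card_union_of_disjoint hd]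
        refine Nat.cast_le.2 (card_le_card (union_subset hsub fun y hy => ?_))
        simp only [hN, mem_filter] at hy
        simp only [neighborhoodBall, mem_union, mem_filter, mem_univ, true_and]
        exact Or.inr hy.2
      -- Each ball contains `U`, so every step gains at least `s * β` vertices; this linear growth
      -- suffices.
      have h5 : s * β ≤ β * B.card := by nlinarith
      rcases min_le_iff.1 ih with h6 | h6
      · left; linarith [Nat.cast_nonneg (α := ℝ) N.card]
      · right; push_cast; linarith
    · rw [min_le_iff]
      left
      have h1 : (Fintype.card V : ℝ) < 2 * B.card := by exact_mod_cast h
      have h2 : (B.card : ℝ) ≤ (neighborhoodBall G U (r + 1)).card := by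
        exact_mod_cast card_le_card hsub
      linarith

open Finset in
/-- A connected set meeting the ball of radius `r` around `U` reaches `U` after adding `r`
vertices. -/
theorem exists_connected_of_not_disjoint_neighborhoodBall {V : Type*} [Fintype V] [DecidableEq V]
    (G : SimpleGraph V) [DecidableRel G.Adj] (U : Finset V) (r : ℕ) :
    ∀ R : Finset V, (G.induce (R : Set V)).Connected → ¬ Disjoint R (neighborhoodBall G U r) →
      ∃ R' : Finset V, R ⊆ R' ∧ R'.card ≤ R.card + r ∧ (G.induce (R' : Set V)).Connected ∧
        ¬ Disjoint R' U := by
  induction r with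
  | zero => exact fun R hR h => ⟨R, Subset.rfl, le_rfl, hR, h⟩
  | succ r ih =>
    intro R hR h
    obtain ⟨y, hyR, hy⟩ := not_disjoint_iff.1 h
    simp only [neighborhoodBall, mem_union, mem_filter, mem_univ, true_and] at hy
    rcases hy with hy | ⟨x, hx, hxy⟩
    · obtain ⟨R', h1, h2, h3⟩ := ih R hR (not_disjoint_iff.2 ⟨y, hyR, hy⟩)
      exact ⟨R', h1, by omega, h3⟩
    · obtain ⟨R', h1, h2, h3⟩ := ih (insert x R) (induce_insert_connected hR hyR (Or.inr hxy))
        (not_disjoint_iff.2 ⟨x, mem_insert_self _ _, hx⟩)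
      refine ⟨R', (subset_insert _ _).trans h1, ?_, h3⟩
      have := card_insert_le x R
      omega

open Finset in
/-- In an expander any family of `q` sets, each of size at least `s`, is met by a connected set
of size at most `ℓ + 1 + 3 q`, provided that `ℓ s` is large compared to the number of vertices. -/
theorem exists_connected_meeting {V ι : Type*} [Fintype V] [DecidableEq V] [Nonempty V]
    (G : SimpleGraph V) [DecidableRel G.Adj] {D β s : ℝ} (hD : 0 < D) (hβ : 0 ≤ β)
    (hdeg : ∀ v, (G.degree v : ℝ) ≤ D)
    (hexp : ∀ S : Finset V, S.Nonempty → 2 * S.card ≤ Fintype.card V →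
      β * D * S.card ≤ (G.interedges S Sᶜ).card)
    (J : Finset ι) (U : ι → Finset V) (hU : ∀ j ∈ J, s ≤ (U j).card) {l N : ℕ}
    (hl : Real.log 2 * Fintype.card V ≤ β ^ 2 / 16 * l * (s * β))
    (hN : N * Real.exp (-(β ^ 2 / 32 * l)) ≤ 1) (hJN : 3 * J.card < N) :
    ∃ R : Finset V, (G.induce (R : Set V)).Connected ∧ R.card ≤ l + 1 + 3 * J.card ∧
      ∀ j ∈ J, ¬ Disjoint R (U j) := by
  have hV : (0 : ℝ) < Fintype.card V := by exact_mod_cast Fintype.card_pos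
  have hexp' : ∀ S : Finset V, S.Nonempty → 2 * S.card ≤ Fintype.card V →
      β * D * S.card ≤ ∑ u ∈ S, ∑ v ∈ Sᶜ, adjWeight G u v := fun S h1 h2 => by
    rw [← card_interedges_eq_sum]; exact hexp S h1 h2
  have hdeg' : ∀ u, ∑ v, adjWeight G u v ≤ D := fun u => by rw [sum_adjWeight]; exact hdeg u
  set W : ι × ℕ → Finset V := fun p => neighborhoodBall G (U p.1) p.2 with hW
  set e : ℝ := Real.exp (-(β ^ 2 / 32 * l)) with he
  have hmiss : ∀ p ∈ J ×ˢ range N, ∑ v, avoidProb (adjWeight G) D (W p)ᶜ l v ≤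
      Fintype.card V * (e + (1 / 2) ^ p.2) := fun p hp => by
    refine (sum_avoidProb_le (adjWeight_comm G) (adjWeight_nonneg G) hD hβ hdeg' hexp' (W p) l).trans
      (mul_le_mul_of_nonneg_left ?_ hV.le)
    have h1 := min_le_card_neighborhoodBall G hD hβ hdeg hexp (hU p.1 (mem_product.1 hp).1) p.2
    rcases min_le_iff.1 h1 with h2 | h2
    · have h3 : 1 / 2 ≤ ((W p).card : ℝ) / Fintype.card V := by
        rw [le_div_iff₀ hV]; linarith
      have h4 : Real.exp (-(β ^ 2 / 16 * (((W p).card : ℝ) / Fintype.card V) * l)) ≤ e := by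
        refine Real.exp_le_exp.2 (neg_le_neg ?_)
        have h5 : (0 : ℝ) ≤ β ^ 2 / 16 * l := by positivity
        nlinarith
      have : (0 : ℝ) ≤ (1 / 2) ^ p.2 := by positivity
      linarith
    · have h3 : Real.log 2 * p.2 ≤ β ^ 2 / 16 * (((W p).card : ℝ) / Fintype.card V) * l := by
        rw [mul_div_assoc', div_mul_eq_mul_div, le_div_iff₀ hV]
        have h5 : (0 : ℝ) ≤ β ^ 2 / 16 * l := by positivity
        have h6 := mul_le_mul_of_nonneg_left h2 h5
        have h7 := mul_le_mul_of_nonneg_right hl (Nat.cast_nonneg (α := ℝ) p.2)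
        calc _ = Real.log 2 * Fintype.card V * p.2 := by ring
          _ ≤ _ := h7
          _ = β ^ 2 / 16 * l * (s * β * p.2) := by ring
          _ ≤ _ := h6
          _ = _ := by ring
      have h4 : Real.exp (-(β ^ 2 / 16 * (((W p).card : ℝ) / Fintype.card V) * l)) ≤
          (1 / 2) ^ p.2 := by
        refine (Real.exp_le_exp.2 (neg_le_neg h3)).trans_eq ?_
        rw [← Real.rpow_natCast, Real.rpow_def_of_pos (by norm_num), one_div, Real.log_inv]
        ring_nf
      have : 0 ≤ e := (Real.exp_pos _).le
      linarith
  -- For each target the geometric series contributes at most `2` and the `N` terms `e` at most `1`.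
  have hgeom : ∑ p ∈ J ×ˢ range N, (e + (1 / 2 : ℝ) ^ p.2) ≤ 3 * J.card := by
    rw [sum_product]
    have h1 : ∑ r ∈ range N, (e + (1 / 2 : ℝ) ^ r) ≤ 3 := by
      rw [sum_add_distrib, sum_const, card_range, nsmul_eq_mul]
      have h2 := sum_geometric_two_le N
      linarith
    simp only [sum_const, nsmul_eq_mul]
    nlinarith [Nat.cast_nonneg (α := ℝ) J.card]
  obtain ⟨v₀, -, hv₀⟩ : ∃ v ∈ (univ : Finset V),
      ∑ p ∈ J ×ˢ range N, avoidProb (adjWeight G) D (W p)ᶜ l v ≤ 3 * J.card := by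
    refine exists_le_of_sum_le univ_nonempty ?_
    rw [sum_comm, sum_const, card_univ, nsmul_eq_mul]
    refine (sum_le_sum hmiss).trans ?_
    rw [← mul_sum]
    exact mul_le_mul_of_nonneg_left hgeom hV.le
  obtain ⟨R₀, -, hcard₀, hconn₀, hmiss₀⟩ :=
    exists_connected_card_disjoint_le G hD hdeg W l (J ×ˢ range N) v₀
  set m : ι → ℕ := fun j =>
    ((range N).filter fun r => Disjoint R₀ (neighborhoodBall G (U j) r)).card with hm
  have hsum : ∑ j ∈ J, m j ≤ 3 * J.card := by
    have h1 : ((J ×ˢ range N).filter fun p => Disjoint R₀ (W p)).card = ∑ j ∈ J, m j := by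
      simp only [hm, card_filter, sum_product, hW]
    rw [← h1]
    exact_mod_cast hmiss₀.trans hv₀
  -- Balls are nested, so missing the ball of radius `m j` means missing the `m j + 1` radii `0, …,
  -- m j`, one more than were counted. `3 * J.card < N` keeps these radii in range.
  have hhit : ∀ j ∈ J, ¬ Disjoint R₀ (neighborhoodBall G (U j) (m j)) := fun j hj hd => by
    have h1 : m j < N := ((single_le_sum (fun _ _ => Nat.zero_le _) hj).trans hsum).trans_lt hJN
    have h2 : range (m j + 1) ⊆
        (range N).filter fun r => Disjoint R₀ (neighborhoodBall G (U j) r) := fun r hr => by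
      have hr : r ≤ m j := by simpa [Nat.lt_succ_iff] using hr
      exact mem_filter.2 ⟨mem_range.2 (by omega),
        hd.mono_right (neighborhoodBall_mono G (U j) hr)⟩
    have h3 := card_le_card h2
    rw [card_range] at h3
    change m j + 1 ≤ m j at h3
    omega
  have hattach : ∀ K ⊆ J, ∃ R : Finset V, R₀ ⊆ R ∧ R.card ≤ R₀.card + ∑ j ∈ K, m j ∧
      (G.induce (R : Set V)).Connected ∧ ∀ j ∈ K, ¬ Disjoint R (U j) := by
    classical
    intro K
    induction K using Finset.induction_on with
    | empty => exact fun _ => ⟨R₀, Subset.rfl, by simp, hconn₀, by simp⟩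
    | insert j K hjK ih =>
      intro hK
      obtain ⟨R, h1, h2, h3, h4⟩ := ih ((subset_insert _ _).trans hK)
      obtain ⟨R', k1, k2, k3, k4⟩ := exists_connected_of_not_disjoint_neighborhoodBall G (U j) (m j)
        R h3 fun hd => hhit j (hK (mem_insert_self _ _)) (hd.mono_left h1)
      refine ⟨R', h1.trans k1, ?_, k3, fun i hi => ?_⟩
      · rw [sum_insert hjK]; omega
      · rcases mem_insert.1 hi with rfl | hi
        · exact k4
        · exact fun hd => h4 i hi (hd.mono_left k1)
  obtain ⟨R, -, h2, h3, h4⟩ := hattach J Subset.rfl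
  exact ⟨R, h3, by omega, h4⟩

open Finset in
/-- In a graph where sets of at most half of the vertices have nonempty boundary, a connected set
extends to a connected set of any prescribed size up to half of the vertices. -/
theorem exists_connected_superset_card_eq {V : Type*} [Fintype V] [DecidableEq V]
    (G : SimpleGraph V) [DecidableRel G.Adj]
    (hexp : ∀ S : Finset V, S.Nonempty → 2 * S.card ≤ Fintype.card V →
      (G.interedges S Sᶜ).Nonempty)
    {L : ℕ} (hL : 2 * L ≤ Fintype.card V) (i : ℕ) :
    ∀ R : Finset V, (G.induce (R : Set V)).Connected → R.card + i = L →
      ∃ R' : Finset V, R ⊆ R' ∧ R'.card = L ∧ (G.induce (R' : Set V)).Connected := by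
  induction i with
  | zero => exact fun R hR h => ⟨R, Subset.rfl, h, hR⟩
  | succ i ih =>
    intro R hR h
    obtain ⟨x⟩ := hR.nonempty
    obtain ⟨⟨u, v⟩, huv⟩ := hexp R ⟨x.1, x.2⟩ (by omega)
    rw [SimpleGraph.interedges, Rel.mem_interedges_iff, mem_compl] at huv
    obtain ⟨R', h1, h2, h3⟩ := ih (insert v R)
      (induce_insert_connected hR huv.1 (Or.inr huv.2.2.symm))
      (by rw [card_insert_of_notMem huv.2.1]; omega)
    exact ⟨R', (subset_insert _ _).trans h1, h2, h3⟩

open Finset in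
/-- Inside an expanding vertex set `W` there are connected sets of a prescribed size meeting all
members of a family of large subsets. -/
theorem exists_connected_subset_meeting {V ι : Type*} [Fintype V] [DecidableEq V]
    (G : SimpleGraph V) [DecidableRel G.Adj] {D β s : ℝ} (hD : 0 < D) (hβ : 0 < β)
    (hdeg : ∀ v, (G.degree v : ℝ) ≤ D) (W : Finset V) (hW : W.Nonempty)
    (hexp : ∀ S ⊆ W, S.Nonempty → 2 * S.card ≤ W.card →
      β * D * S.card ≤ (G.interedges S (W \ S)).card)
    (J : Finset ι) (U : ι → Finset V) (hUW : ∀ j ∈ J, U j ⊆ W) (hU : ∀ j ∈ J, s ≤ (U j).card)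
    {l N L : ℕ} (hl : Real.log 2 * W.card ≤ β ^ 2 / 16 * l * (s * β))
    (hN : N * Real.exp (-(β ^ 2 / 32 * l)) ≤ 1) (hJN : 3 * J.card < N)
    (hL : l + 1 + 3 * J.card ≤ L) (hLW : 2 * L ≤ W.card) :
    ∃ R ⊆ W, (G.induce (R : Set V)).Connected ∧ R.card = L ∧ ∀ j ∈ J, ¬ Disjoint R (U j) := by
  -- The walk runs in the graph induced on `W`, whose degrees are still at most `D`.
  set H : SimpleGraph W := G.comap (Subtype.val : W → V) with hH
  have hdec : DecidableRel H.Adj := Classical.decRel _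
  set em : W ↪ V := Function.Embedding.subtype _ with hem
  have hemW : ∀ S : Finset W, S.map em ⊆ W := fun S x hx => by
    obtain ⟨y, -, rfl⟩ := mem_map.1 hx
    exact y.2
  have hw : ∀ u v : W, adjWeight H u v = adjWeight G u v := fun u v => by
    simp [adjWeight, hH]
  have hcompl : ∀ S : Finset W, Sᶜ.map em = W \ S.map em := fun S => by
    ext x
    simp only [mem_map, mem_compl, mem_sdiff, hem, Function.Embedding.subtype_apply]
    constructor
    · rintro ⟨y, hy, rfl⟩
      refine ⟨y.2, ?_⟩
      rintro ⟨z, hz, hzy⟩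
      exact hy (Subtype.ext hzy ▸ hz)
    · rintro ⟨hx, hn⟩
      exact ⟨⟨x, hx⟩, fun h => hn ⟨_, h, rfl⟩, rfl⟩
  have hinter : ∀ S : Finset W,
      ((H.interedges S Sᶜ).card : ℝ) = (G.interedges (S.map em) (W \ S.map em)).card := fun S => by
    rw [card_interedges_eq_sum, card_interedges_eq_sum, ← hcompl]
    simp only [sum_map, hw]
    rfl
  have hdegH : ∀ v, (H.degree v : ℝ) ≤ D := fun v => by
    refine le_trans ?_ (hdeg v)
    rw [← sum_adjWeight, ← sum_adjWeight]
    simp_rw [hw]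
    rw [sum_coe_sort W (fun u => adjWeight G v u)]
    exact sum_le_sum_of_subset_of_nonneg (subset_univ _) fun _ _ _ => adjWeight_nonneg G _ _
  have hexpH : ∀ S : Finset W, S.Nonempty → 2 * S.card ≤ Fintype.card W →
      β * D * S.card ≤ (H.interedges S Sᶜ).card := fun S h1 h2 => by
    rw [hinter, ← card_map em]
    exact hexp _ (hemW S) (h1.map) (by rwa [card_map, ← Fintype.card_coe W])
  have : Nonempty W := hW.to_subtype
  set U' : ι → Finset W := fun j => univ.filter fun x => (x : V) ∈ U j with hU'
  have hUmap : ∀ j ∈ J, (U' j).map em = U j := fun j hj => by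
    ext x
    simp only [hU', mem_map, mem_filter, mem_univ, true_and, hem,
      Function.Embedding.subtype_apply]
    exact ⟨fun ⟨y, hy, h⟩ => h ▸ hy, fun h => ⟨⟨x, hUW j hj h⟩, h, rfl⟩⟩
  obtain ⟨R₁, hconn₁, hcard₁, hmeet₁⟩ := exists_connected_meeting H hD hβ.le hdegH hexpH J U'
    (fun j hj => by rw [← card_map em, hUmap j hj]; exact hU j hj)
    (by rwa [Fintype.card_coe]) hN hJN
  obtain ⟨R, hsub, hcard, hconn⟩ := exists_connected_superset_card_eq H
    (fun S h1 h2 => by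
      have h3 := hexpH S h1 h2
      have h4 : 0 < β * D * S.card := by
        have : (0 : ℝ) < S.card := by exact_mod_cast h1.card_pos
        positivity
      have h5 : (0 : ℝ) < (H.interedges S Sᶜ).card := h4.trans_le h3
      exact card_pos.1 (by exact_mod_cast h5))
    (L := L) (by rwa [Fintype.card_coe]) (L - R₁.card) R₁ hconn₁ (by omega)
  refine ⟨R.map em, hemW R, ?_, by rwa [card_map], fun j hj => ?_⟩
  · let φ : H.induce (R : Set W) →g G.induce ((R.map em : Finset V) : Set V) :=
      { toFun := fun x => ⟨x.1.1, mem_coe.2 (mem_map_of_mem em x.2)⟩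
        map_rel' := fun h => h }
    refine hconn.map φ ?_
    rintro ⟨x, hx⟩
    obtain ⟨y, hy, rfl⟩ := mem_map.1 (mem_coe.1 hx)
    exact ⟨⟨y, hy⟩, rfl⟩
  · rw [← hUmap j hj, disjoint_map]
    exact fun hd => hmeet₁ j hj (hd.mono_left hsub)

/-! ### Partial clique models -/

theorem card_interedges_union_left_le {V : Type*} [DecidableEq V] (G : SimpleGraph V)
    [DecidableRel G.Adj] {P Q Z Z₁ Z₂ : Finset V} (h₁ : Z ⊆ Z₁) (h₂ : Z ⊆ Z₂) :
    (G.interedges (P ∪ Q) Z).card ≤ (G.interedges P Z₁).card + (G.interedges Q Z₂).card := by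
  refine (Finset.card_le_card fun e he => ?_).trans (Finset.card_union_le _ _)
  simp only [SimpleGraph.interedges, Rel.mem_interedges_iff, Finset.mem_union] at he ⊢
  obtain ⟨h | h, h', h''⟩ := he
  · exact Or.inl ⟨h, h₁ h', h''⟩
  · exact Or.inr ⟨h, h₂ h', h''⟩

theorem card_interedges_le_add_right {V : Type*} [DecidableEq V] (G : SimpleGraph V)
    [DecidableRel G.Adj] {P Y Z Z' : Finset V} (h : Y ⊆ Z ∪ Z') :
    (G.interedges P Y).card ≤ (G.interedges P Z).card + (G.interedges P Z').card := by
  refine (Finset.card_le_card fun e he => ?_).trans (Finset.card_union_le _ _)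
  simp only [SimpleGraph.interedges, Rel.mem_interedges_iff, Finset.mem_union] at he ⊢
  rcases Finset.mem_union.1 (h he.2.1) with h' | h'
  · exact Or.inl ⟨he.1, h', he.2.2⟩
  · exact Or.inr ⟨he.1, h', he.2.2⟩

/-- A partial clique model: at most `k` pairwise disjoint and pairwise adjacent connected sets of
size `L`, and a set `A` of discarded vertices sending few edges to the unused vertices. -/
structure IsPartialModel {V : Type*} [Fintype V] [DecidableEq V] (G : SimpleGraph V)
    [DecidableRel G.Adj] (D β : ℝ) (k L : ℕ) (A : Finset V) (𝓑 : Finset (Finset V)) : Prop where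
  card_le : 𝓑.card ≤ k
  card_eq : ∀ B ∈ 𝓑, B.card = L
  connected : ∀ B ∈ 𝓑, (G.induce (B : Set V)).Connected
  disjoint_left : ∀ B ∈ 𝓑, Disjoint A B
  disjoint : ∀ B ∈ 𝓑, ∀ C ∈ 𝓑, B ≠ C → Disjoint B C
  adj : ∀ B ∈ 𝓑, ∀ C ∈ 𝓑, B ≠ C → ∃ x ∈ B, ∃ y ∈ C, G.Adj x y
  sparse : ((G.interedges A (A ∪ 𝓑.biUnion id)ᶜ).card : ℝ) ≤ β * D * A.card
  -- Two thirds rather than one half leaves room to discard up to half of the unused vertices at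
  -- once.
  card_discarded_le : 3 * A.card ≤ 2 * Fintype.card V

namespace IsPartialModel

variable {V : Type*} [Fintype V] [DecidableEq V] {G : SimpleGraph V} [DecidableRel G.Adj]
  {D β : ℝ} {k L : ℕ} {A : Finset V} {𝓑 : Finset (Finset V)}

theorem empty : IsPartialModel G D β k L ∅ ∅ where
  card_le := by simp
  card_eq := by simp
  connected := by simp
  disjoint_left := by simp
  disjoint := by simp
  adj := by simp
  sparse := by simp [SimpleGraph.interedges]
  card_discarded_le := by simp

/-- Sparsity is additive: the old part sees no new unused vertices, and `S` is sparse itself. `S`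
will be either a poorly expanding part of the unused set or a branch set with few edges to it. -/
theorem discard (h : IsPartialModel G D β k L A 𝓑) {S : Finset V} {𝓒 : Finset (Finset V)}
    (hAS : Disjoint A S) (hS : 3 * (A.card + S.card) ≤ 2 * Fintype.card V) (h𝓒 : 𝓒 ⊆ 𝓑)
    (hS𝓒 : ∀ B ∈ 𝓒, Disjoint S B) (hsub : (A ∪ S ∪ 𝓒.biUnion id)ᶜ ⊆ (A ∪ 𝓑.biUnion id)ᶜ)
    (hsparse : ((G.interedges S (A ∪ S ∪ 𝓒.biUnion id)ᶜ).card : ℝ) ≤ β * D * S.card) :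
    IsPartialModel G D β k L (A ∪ S) 𝓒 where
  card_le := (Finset.card_le_card h𝓒).trans h.card_le
  card_eq := fun B hB => h.card_eq B (h𝓒 hB)
  connected := fun B hB => h.connected B (h𝓒 hB)
  disjoint_left := fun B hB =>
    Finset.disjoint_union_left.2 ⟨h.disjoint_left B (h𝓒 hB), hS𝓒 B hB⟩
  disjoint := fun B hB C hC => h.disjoint B (h𝓒 hB) C (h𝓒 hC)
  adj := fun B hB C hC => h.adj B (h𝓒 hB) C (h𝓒 hC)
  sparse := by
    have h1 := card_interedges_union_left_le G (P := A) (Q := S) hsub Finset.Subset.rfl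
    have h2 : ((G.interedges (A ∪ S) (A ∪ S ∪ 𝓒.biUnion id)ᶜ).card : ℝ) ≤
        (G.interedges A (A ∪ 𝓑.biUnion id)ᶜ).card +
          (G.interedges S (A ∪ S ∪ 𝓒.biUnion id)ᶜ).card := by exact_mod_cast h1
    rw [Finset.card_union_of_disjoint hAS]
    push_cast
    have := h.sparse
    linarith
  card_discarded_le := by rwa [Finset.card_union_of_disjoint hAS]

theorem insert_branch (h : IsPartialModel G D β k L A 𝓑) (hk : 𝓑.card < k) {R : Finset V}
    (hR : R ⊆ (A ∪ 𝓑.biUnion id)ᶜ) (hconn : (G.induce (R : Set V)).Connected)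
    (hcard : R.card = L) (hadj : ∀ B ∈ 𝓑, ∃ x ∈ B, ∃ y ∈ R, G.Adj x y) :
    IsPartialModel G D β k L A (insert R 𝓑) := by
  have hRA : Disjoint A R := Finset.disjoint_right.2 fun x hx hxA => by
    simpa [hxA] using hR hx
  have hRB : ∀ B ∈ 𝓑, Disjoint B R := fun B hB => Finset.disjoint_right.2 fun x hx hxB => by
    have := hR hx
    simp only [Finset.mem_compl, Finset.mem_union, Finset.mem_biUnion, id, not_or] at this
    exact this.2 ⟨B, hB, hxB⟩
  refine ⟨(Finset.card_insert_le _ _).trans hk, ?_, ?_, ?_, ?_, ?_, ?_, h.card_discarded_le⟩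
  · rintro B hB
    rcases Finset.mem_insert.1 hB with rfl | hB
    exacts [hcard, h.card_eq B hB]
  · rintro B hB
    rcases Finset.mem_insert.1 hB with rfl | hB
    exacts [hconn, h.connected B hB]
  · rintro B hB
    rcases Finset.mem_insert.1 hB with rfl | hB
    exacts [hRA, h.disjoint_left B hB]
  · rintro B hB C hC hne
    rcases Finset.mem_insert.1 hB with rfl | hB' <;>
      rcases Finset.mem_insert.1 hC with rfl | hC'
    exacts [absurd rfl hne, (hRB C hC').symm, hRB B hB', h.disjoint B hB' C hC' hne]
  · rintro B hB C hC hne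
    rcases Finset.mem_insert.1 hB with rfl | hB' <;>
      rcases Finset.mem_insert.1 hC with rfl | hC'
    · exact absurd rfl hne
    · obtain ⟨x, hx, y, hy, hxy⟩ := hadj C hC'
      exact ⟨y, hy, x, hx, hxy.symm⟩
    · exact hadj B hB'
    · exact h.adj B hB' C hC' hne
  · refine le_trans (Nat.cast_le.2 (Finset.card_le_card ?_)) h.sparse
    refine Rel.interedges_mono Finset.Subset.rfl (Finset.compl_subset_compl.2 ?_)
    exact Finset.union_subset_union_right
      (Finset.biUnion_subset_biUnion_of_subset_left _ (Finset.subset_insert _ _))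

theorem card_biUnion_le (h : IsPartialModel G D β k L A 𝓑) : (𝓑.biUnion id).card ≤ k * L :=
  (Finset.card_biUnion_le_card_mul _ _ L fun B hB => (h.card_eq B hB).le).trans
    (Nat.mul_le_mul_right L h.card_le)

/-- In an expander the discarded set of a partial model is small. -/
theorem mul_card_le (h : IsPartialModel G D β k L A 𝓑) (hD : 0 < D) (hβ : 0 < β)
    (hdeg : ∀ v, (G.degree v : ℝ) ≤ D)
    (hexp : ∀ S : Finset V, S.Nonempty → 2 * S.card ≤ Fintype.card V →
      4 * β * D * S.card ≤ (G.interedges S Sᶜ).card) :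
    β * A.card ≤ k * L := by
  have hexp' : ∀ S : Finset V, 2 * S.card ≤ Fintype.card V →
      4 * β * D * S.card ≤ (G.interedges S Sᶜ).card := fun S hS => by
    rcases S.eq_empty_or_nonempty with rfl | hne
    · simp
    · exact hexp S hne hS
  have hβD : 0 < β * D := mul_pos hβ hD
  -- If `A` exceeds half, its complement still has at least `|A| / 2` vertices; this halves the
  -- factor `4`.
  have h1 : 2 * (β * D) * A.card ≤ (G.interedges A Aᶜ).card := by
    rcases le_or_gt (2 * A.card) (Fintype.card V) with h1 | h1
    · have := hexp' A h1
      nlinarith [mul_nonneg hβD.le (Nat.cast_nonneg (α := ℝ) A.card)]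
    · have h2 : A.card + Aᶜ.card = Fintype.card V := Finset.card_add_card_compl A
      have h3 := hexp' Aᶜ (by omega)
      rw [compl_compl] at h3
      have h4 : (G.interedges Aᶜ A).card = (G.interedges A Aᶜ).card :=
        have : Std.Symm G.Adj := ⟨fun _ _ h => h.symm⟩
        Rel.card_interedges_comm _ _
      rw [h4] at h3
      have h5 : A.card ≤ 2 * Aᶜ.card := by have := h.card_discarded_le; omega
      have h6 : (A.card : ℝ) ≤ 2 * Aᶜ.card := by exact_mod_cast h5
      nlinarith [mul_le_mul_of_nonneg_left h6 hβD.le]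
  -- At least half of these edges must end in branch sets, which can receive at most `D * (k * L)`.
  have h2 : ((G.interedges A Aᶜ).card : ℝ) ≤ (G.interedges A (A ∪ 𝓑.biUnion id)ᶜ).card +
      (G.interedges A (𝓑.biUnion id)).card := by
    exact_mod_cast card_interedges_le_add_right G fun x hx => by
      simp only [Finset.mem_compl, Finset.mem_union] at hx ⊢
      tauto
  have h3 := card_interedges_le_mul_card_right G hD.le hdeg A (𝓑.biUnion id)
  have h4 : ((𝓑.biUnion id).card : ℝ) ≤ k * L := by exact_mod_cast h.card_biUnion_le
  have h5 := h.sparse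
  have h6 : D * (β * A.card) ≤ D * (k * L) := by
    have := mul_le_mul_of_nonneg_left h4 hD.le
    nlinarith
  exact le_of_mul_le_mul_left h6 hD

theorem hasMinor (h : IsPartialModel G D β k L A 𝓑) (hk : 𝓑.card = k) :
    HasMinor G (⊤ : SimpleGraph (Fin k)) := by
  let e := 𝓑.equivFinOfCardEq hk
  have hne : ∀ i j, i ≠ j → ((e.symm i : Finset V)) ≠ e.symm j := fun i j hij h =>
    hij (e.symm.injective (Subtype.ext h))
  refine ⟨fun i => ((e.symm i : Finset V) : Set V), fun i => h.connected _ (e.symm i).2,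
    fun i j hij => ?_, fun i j hij => ?_⟩
  · exact Finset.disjoint_coe.2 (h.disjoint _ (e.symm i).2 _ (e.symm j).2 (hne i j hij))
  · exact h.adj _ (e.symm i).2 _ (e.symm j).2 (hne i j hij)

end IsPartialModel

/-! ### The extremal argument and the choice of constants -/

open Finset in
/-- An edge expander contains a clique minor of the order of the square root of its size. -/
theorem hasMinor_top_of_expander {V : Type*} [Fintype V] [DecidableEq V] (G : SimpleGraph V)
    [DecidableRel G.Adj] {D β : ℝ} (hD : 0 < D) (hβ : 0 < β) (hdeg : ∀ v, (G.degree v : ℝ) ≤ D)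
    (hexp : ∀ S : Finset V, S.Nonempty → 2 * S.card ≤ Fintype.card V →
      4 * β * D * S.card ≤ (G.interedges S Sᶜ).card)
    {E K k : ℕ} (hE : 10 ≤ E) (hEβ : 10 ≤ E * β) (hK : 96 ≤ K * β ^ 2) (hKE : 64 * E ≤ K * β ^ 4)
    (hk : 0 < k) (hn : E * (K + 4) * k ^ 2 ≤ Fintype.card V)
    (hn' : Fintype.card V ≤ 4 * (E * (K + 4) * k ^ 2)) :
    HasMinor G (⊤ : SimpleGraph (Fin k)) := by
  classical
  set n := Fintype.card V with hn_def
  set L := (K + 4) * k with hL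
  have hkL : E * (k * L) ≤ n := by rw [hL]; refine le_trans (le_of_eq ?_) hn; ring
  have hkL10 : 10 * (k * L) ≤ n := (Nat.mul_le_mul_right _ hE).trans hkL
  have hL10 : 10 * L ≤ n := le_trans (by nlinarith) hkL10
  have hLpos : 0 < L := by positivity
  set P : Finset (Finset V × Finset (Finset V)) :=
    univ.filter fun p => IsPartialModel G D β k L p.1 p.2 with hP
  have hPne : P.Nonempty :=
    ⟨(∅, ∅), by simpa [hP] using IsPartialModel.empty⟩
  obtain ⟨⟨A, 𝓑⟩, hmem, hmax⟩ :=
    -- There are at most `k` branch sets, so the weight `k + 1` makes this order lexicographic: one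
    -- more discarded vertex outweighs any loss of branches.
    P.exists_max_image (fun p => p.1.card * (k + 1) + p.2.card) hPne
  have hmod : IsPartialModel G D β k L A 𝓑 := by simpa [hP] using hmem
  replace hmax : ∀ A' 𝓑', IsPartialModel G D β k L A' 𝓑' →
      A'.card * (k + 1) + 𝓑'.card ≤ A.card * (k + 1) + 𝓑.card := fun A' 𝓑' h =>
    hmax (A', 𝓑') (by simpa [hP] using h)
  have hdiscard : ∀ S : Finset V, S.Nonempty → Disjoint A S → ∀ 𝓒,
      ¬ IsPartialModel G D β k L (A ∪ S) 𝓒 := fun S hS hAS 𝓒 h => by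
    have h1 := hmax _ _ h
    rw [card_union_of_disjoint hAS] at h1
    have h2 := hS.card_pos
    have h3 := hmod.card_le
    nlinarith [Nat.mul_le_mul_right (k + 1) h2]
  have hA : 10 * A.card ≤ n := by
    have h1 := hmod.mul_card_le hD hβ hdeg hexp
    have h2 : (E : ℝ) * (k * L) ≤ n := by exact_mod_cast hkL
    have h3 := mul_le_mul_of_nonneg_left h1 (Nat.cast_nonneg (α := ℝ) E)
    have h4 := mul_le_mul_of_nonneg_right hEβ (Nat.cast_nonneg (α := ℝ) A.card)
    have h5 : (10 : ℝ) * A.card ≤ n := by linarith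
    exact_mod_cast h5
  set X := 𝓑.biUnion id with hX
  set W := (A ∪ X)ᶜ with hW
  have hXcard : 10 * X.card ≤ n := (Nat.mul_le_mul_left 10 hmod.card_biUnion_le).trans hkL10
  have hWcard : 8 * n ≤ 10 * W.card := by
    have h1 : (A ∪ X).card + W.card = n := card_add_card_compl _
    have h2 := card_union_le A X
    omega
  have hWn : W.card ≤ n := card_le_univ W
  have hAW : Disjoint A W := disjoint_right.2 fun x hx hxA => by simp [hW, hxA] at hx
  have hBX : ∀ B ∈ 𝓑, B ⊆ X := fun B hB => subset_biUnion_of_mem id hB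
  have hBW : ∀ B ∈ 𝓑, Disjoint B W := fun B hB => disjoint_right.2 fun x hx hxB => by
    simp [hW, hBX B hB hxB] at hx
  by_contra hcon
  have hlt : 𝓑.card < k := lt_of_le_of_ne hmod.card_le fun h => hcon (hmod.hasMinor h)
  have hexpW : ∀ S ⊆ W, S.Nonempty → 2 * S.card ≤ W.card →
      β * D * S.card ≤ (G.interedges S (W \ S)).card := fun S hSW hS hcard => by
    by_contra! hcut
    have hAS := hAW.mono_right hSW
    have heq : (A ∪ S ∪ X)ᶜ = W \ S := by
      ext x; simp only [hW, mem_compl, mem_union, mem_sdiff]; tauto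
    refine hdiscard S hS hAS 𝓑 (hmod.discard hAS (by omega) Subset.rfl
      (fun B hB => ((hBW B hB).mono_right hSW).symm) ?_ ?_)
    · rw [← hX, heq]; exact sdiff_subset
    · rw [← hX, heq]; exact hcut.le
  have hbranch : ∀ B ∈ 𝓑, β * D * B.card ≤ (G.interedges B W).card := fun B hB => by
    by_contra! hcut
    have hcB := hmod.card_eq B hB
    have hBne : B.Nonempty := card_pos.1 (by omega)
    have heq : (A ∪ B ∪ (𝓑.erase B).biUnion id)ᶜ = W := by
      rw [hW, hX, ← insert_erase hB, biUnion_insert, erase_insert_eq_erase, erase_idem,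
        id, union_assoc]
    refine hdiscard B hBne (hmod.disjoint_left B hB) (𝓑.erase B)
      (hmod.discard (hmod.disjoint_left B hB) (by omega) (erase_subset _ _)
      (fun C hC => hmod.disjoint B hB C (mem_of_mem_erase hC) (ne_of_mem_erase hC).symm) ?_ ?_)
    · rw [heq]
    · rw [heq]; exact hcut.le
  have hk0 : (0 : ℝ) < k := by exact_mod_cast hk
  -- Since `𝓑.card < k`, the walk of length `K * k` and the attaching paths fit into `L = (K + 4) *
  -- k`, and `3 * 𝓑.card < 3 * k = N`.
  obtain ⟨R, hRW, hRconn, hRcard, hRmeet⟩ := exists_connected_subset_meeting G hD hβ hdeg W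
    (card_pos.1 (by omega)) hexpW 𝓑 (fun B => W.filter fun y => ∃ x ∈ B, G.Adj x y)
    (fun B _ => filter_subset _ _) (s := β * L) (l := K * k) (N := 3 * k) (L := L)
    (fun B hB => by
      have h1 := (hbranch B hB).trans (card_interedges_le_mul_card_neighbors G hdeg B W)
      rw [hmod.card_eq B hB] at h1
      refine le_of_mul_le_mul_left ?_ hD
      linarith)
    (by
      have h1 : Real.log 2 * W.card ≤ W.card := by
        have := Real.log_two_lt_d9
        nlinarith [Nat.cast_nonneg (α := ℝ) W.card]
      have h2 : (W.card : ℝ) ≤ 4 * (E * (K + 4) * k ^ 2) := by exact_mod_cast hWn.trans hn'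
      refine (h1.trans h2).trans ?_
      have h3 : (0 : ℝ) ≤ (K + 4) * k ^ 2 / 16 := by positivity
      have h4 := mul_le_mul_of_nonneg_right hKE h3
      rw [hL]
      push_cast
      linarith)
    (by
      rw [Real.exp_neg, ← div_eq_mul_inv, div_le_one (Real.exp_pos _)]
      have h1 := Real.add_one_le_exp (β ^ 2 / 32 * ((K * k : ℕ) : ℝ))
      have h2 := mul_le_mul_of_nonneg_right hK hk0.le
      push_cast at h1 ⊢
      linarith)
    (by omega)
    (by rw [hL, add_mul]; omega)
    (by omega)
  have hnew := hmod.insert_branch hlt hRW hRconn hRcard fun B hB => by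
    obtain ⟨y, hyR, hy⟩ := not_disjoint_iff.1 (hRmeet B hB)
    obtain ⟨-, x, hx, hxy⟩ := mem_filter.1 hy
    exact ⟨x, hx, y, hyR, hxy⟩
  have hRnot : R ∉ 𝓑 := fun hR => by
    obtain ⟨x, hx⟩ := card_pos.1 (hRcard.symm ▸ hLpos : 0 < R.card)
    exact disjoint_left.1 (hBW R hR) hx (hRW hx)
  have h1 := hmax _ _ hnew
  rw [card_insert_of_notMem hRnot] at h1
  omega

theorem theorem7 (α : ℝ) (hα : 0 < α) :
    ∃ c : ℝ, 0 < c ∧ ∃ n₀ : ℕ,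
      ∀ (V : Type*) [Fintype V] [DecidableEq V] (G : SimpleGraph V) [DecidableRel G.Adj],
        n₀ ≤ Fintype.card V →
        0 < G.maxDegree →
        α * (G.maxDegree : ℝ) ≤ edgeIsoperimetricNumber G →
        c * Real.sqrt (Fintype.card V : ℝ) ≤ (cliqueContractionNumber G : ℝ) := by
  -- `hasMinor_top_of_expander` assumes expansion `4 * β * D`.
  set β : ℝ := α / 4 with hβ_def
  have hβ : 0 < β := by positivity
  obtain ⟨E₀, hE₀⟩ := exists_nat_ge (10 / β)
  set E : ℕ := max 10 E₀ with hE_def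
  have hE : 10 ≤ E := le_max_left _ _
  have hEβ : 10 ≤ E * β := by
    rw [div_le_iff₀ hβ] at hE₀
    have : (E₀ : ℝ) ≤ E := by exact_mod_cast le_max_right 10 E₀
    nlinarith
  obtain ⟨K, hK₀⟩ := exists_nat_ge (max (96 / β ^ 2) (64 * E / β ^ 4))
  have hK : 96 ≤ K * β ^ 2 := by
    have := (le_max_left _ _).trans hK₀
    rwa [div_le_iff₀ (by positivity)] at this
  have hKE : 64 * E ≤ K * β ^ 4 := by
    have := (le_max_right _ _).trans hK₀
    rwa [div_le_iff₀ (by positivity)] at this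
  set M : ℕ := E * (K + 4) with hM
  have hMpos : 0 < M := by positivity
  have hM0 : (0 : ℝ) < M := by exact_mod_cast hMpos
  refine ⟨(2 * Real.sqrt M)⁻¹, by positivity, M, ?_⟩
  intro V _ _ G _ hn hd hi
  set n := Fintype.card V with hn_def
  -- For `n ≥ M` this is positive, so `(k + 1)² ≤ 4 k²` and rounding costs a factor of at most `4`
  -- in `n`.
  set k := Nat.sqrt (n / M) with hk_def
  have hk : 0 < k := Nat.sqrt_pos.2 (Nat.div_pos hn hMpos)
  have hkn : M * k ^ 2 ≤ n :=
    (Nat.mul_le_mul_left M (Nat.sqrt_le' _)).trans (Nat.mul_div_le n M)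
  have hkn' : n ≤ 4 * (M * k ^ 2) := by
    have h1 : n / M < (k + 1) ^ 2 := Nat.lt_succ_sqrt' _
    have h2 : n < M * (k + 1) ^ 2 := by
      rw [mul_comm]
      exact (Nat.div_lt_iff_lt_mul hMpos).1 h1
    have h3 : (k + 1) ^ 2 ≤ 4 * k ^ 2 := by nlinarith
    have h4 := Nat.mul_le_mul_left M h3
    linarith
  have hminor : HasMinor G (⊤ : SimpleGraph (Fin k)) := by
    refine hasMinor_top_of_expander G (D := G.maxDegree) (β := β) (by exact_mod_cast hd) hβ
      (fun v => by exact_mod_cast G.degree_le_maxDegree v) (fun S hS hcard => ?_) hE hEβ hK hKE hk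
      hkn hkn'
    have h2 : 2 ≤ Fintype.card V := by have := hS.card_pos; omega
    have h3 := hi.trans ((isLeast_edgeIsoperimetricNumber G h2).2 ⟨S, hS, hcard, rfl⟩)
    rw [le_div_iff₀ (by exact_mod_cast hS.card_pos)] at h3
    rw [hβ_def]
    linarith
  have hle : k ≤ cliqueContractionNumber G := (isGreatest_cliqueContractionNumber G).2 hminor
  refine le_trans ?_ (Nat.cast_le.2 hle)
  rw [inv_mul_le_iff₀ (by positivity)]
  refine (Real.sqrt_le_left (by positivity)).2 ?_
  have h1 : (n : ℝ) ≤ 4 * (M * k ^ 2) := by exact_mod_cast hkn'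
  have h2 := Real.sq_sqrt hM0.le
  calc (n : ℝ) ≤ 4 * (M * k ^ 2) := h1
    _ = (2 * Real.sqrt M * k) ^ 2 := by rw [mul_pow, mul_pow, h2]; ring
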